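/- Let $D$ be the open unit disc in the plane. For $u:D\to\mathbb R$ and $0\le r<1$ write $u_r(\theta)=u(re^{i\theta})$. Let $\|u_r\|_p$ denote the $L^p$ norm of $u_r$ over $[-\pi,\pi]$ with respect to Lebesgue measure $d\theta$, and let $\|u_r\|=\sup_I\left|\int_I u_r\right|$ denote its Alexiewicz norm, the supremum being over all intervals $I\subset\mathbb R$ of length at most $2\pi$. Let $h^{\mathcal{HK}}$ be the space of functions $u:D\to\mathbb R$ that are harmonic in $D$ and satisfy $\|u\|_{\mathcal{HK}}:=\sup_{0\le r<1}\|u_r\|<\infty$. **Theorem.** Let $1\le p\le\infty$, and read $(2\pi)^{1/p}$ as $1$ when $p=\infty$. If $u\in h^{\mathcal{HK}}$, then $$\|u_r\|_p\le(2\pi)^{1/p}\,\frac{2r\,\|u\|_{\mathcal{HK}}}{\pi(1-r)}\quad\text{for }\tfrac12\le r<1,\qquad \|u_r\|_p\le(2\pi)^{1/p}\,\frac{2\,\|u\|_{\mathcal{HK}}}{\pi}\quad\text{for }0\le r\le\tfrac12 .$$ The resulting order relation $\|u_r\|_p=O(1/(1-r))$ is sharp as $r\to1$ in the following sense. For every $1\le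 p\le\infty$ and every $\psi:[0,1)\to(0,\infty)$ with $\psi(r)=o(1/(1-r))$ as $r\to1^-$, there is $u\in h^{\mathcal{HK}}$ with $\limsup_{r\to1^-}\|u_r\|_p/\psi(r)=\infty$. For $p=\infty$, moreover, there are $u\in h^{\mathcal{HK}}$ and $c>0$ such that $\|u_r\|_\infty\ge c/(1-r)$ for all $0\le r<1$. -/

import Mathlib

open Filter Topology MeasureTheory Asymptotics
open scoped ENNReal

/-- The slice `u_r(θ) = u(r e^{iθ})` of a function `u` on the unit disc. -/
noncomputable def slice (u : ℂ → ℝ) (r : ℝ) : ℝ → ℝ :=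
  fun θ => u ((r : ℂ) * Complex.exp ((θ : ℂ) * Complex.I))

/-- The Alexiewicz norm `‖f‖ = sup_I |∫_I f|` of a continuous `2π`-periodic function `f`, the
supremum being over all intervals `I` of length at most `2π`. It takes values in `[0, ∞]`. It is
only used for continuous `f` (slices of harmonic functions); for these the Lebesgue integral over
a bounded interval exists and equals the Henstock–Kurzweil integral. -/
noncomputable def alexiewiczNorm (f : ℝ → ℝ) : ℝ≥0∞ :=
  ⨆ (a : ℝ) (b : ℝ) (_ : a ≤ b ∧ b - a ≤ 2 * Real.pi), ENNReal.ofReal |∫ t in a..b, f t|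

/-- `‖u‖_HK = sup_{0 ≤ r < 1} ‖u_r‖`, with values in `[0, ∞]`. -/
noncomputable def hkNorm (u : ℂ → ℝ) : ℝ≥0∞ :=
  ⨆ (r : ℝ) (_ : 0 ≤ r ∧ r < 1), alexiewiczNorm (slice u r)

/-- The harmonic Hardy space `h^HK`: functions harmonic in the open unit disc with
`‖u‖_HK < ∞`. Values of `u` outside the disc are irrelevant. -/
def harmonicHardyHK : Set (ℂ → ℝ) :=
  {u | InnerProductSpace.HarmonicOnNhd u (Metric.ball (0 : ℂ) 1) ∧ hkNorm u < ∞}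

/-- `‖u_r‖_p`, the `L^p` norm of `u_r` over one period with respect to Lebesgue measure `dθ`
(not normalised). -/
noncomputable def sliceLpNorm (u : ℂ → ℝ) (p : ℝ≥0∞) (r : ℝ) : ℝ≥0∞ :=
  eLpNorm (slice u r) p (volume.restrict (Set.Ioc (-Real.pi) Real.pi))

open scoped Classical in
/-- The factor `(2π)^{1/p}`, read as `1` when `p = ∞`. -/
noncomputable def periodFactor (p : ℝ≥0∞) : ℝ :=
  if p = ∞ then 1 else (2 * Real.pi) ^ (1 / p.toReal)

/-!
For `r < s < 1` the Poisson formula writes `u_r(θ)` as the integral of `u_s(x + θ)` over `[-π, π]`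
against a kernel which is even, positive and decreasing on `[0, π]`. Integrating by parts against
the symmetric primitive `x ↦ ∫ t in -x..x, u_s(t + θ)`, which is bounded by the Alexiewicz norm of
`u_s`, therefore costs only the maximum `(s + r) / (s - r)` of the kernel. Letting `s → 1` gives
`2π |u_r(θ)| ≤ (1 + r) / (1 - r) * ‖u‖_HK`, and both estimates follow by integrating in `θ`.

For `p = ∞` the order is attained by the Poisson kernel with pole at `1`. For the other sharpness
claim, differentiate `∑ bₖ r ^ nₖ sin (nₖ θ)` in `θ`, with `b` positive and summable: the result
has bounded primitives, hence lies in `h^HK`, but its `nₖ`-th Fourier coefficient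
`bₖ nₖ r ^ nₖ` bounds its `L^p` norms from below and is comparable with `bₖ / (1 - r)` at
`r = 1 - 1 / (2 nₖ)`. As `ψ` is `o(1 / (1 - r))`, `nₖ` can be taken so large that `ψ` is much
smaller than `bₖ / (1 - r)` there.
-/

section

open Metric Set InnerProductSpace
open scoped Real

/-! ### Slices and the Alexiewicz norm -/

theorem slice_eq_comp_circleMap (u : ℂ → ℝ) (r : ℝ) : slice u r = u ∘ circleMap 0 r := by
  funext θ
  simp only [slice, Function.comp_apply, circleMap_zero]

theorem circleMap_mem_unit_ball {r : ℝ} (hr₀ : 0 ≤ r) (hr₁ : r < 1) (θ : ℝ) :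
    circleMap 0 r θ ∈ ball (0 : ℂ) 1 := by
  rwa [mem_ball_zero_iff, norm_circleMap_zero, abs_of_nonneg hr₀]

theorem continuous_slice {u : ℂ → ℝ} (hu : ContinuousOn u (ball 0 1)) {r : ℝ} (hr₀ : 0 ≤ r)
    (hr₁ : r < 1) : Continuous (slice u r) := by
  rw [slice_eq_comp_circleMap]
  exact hu.comp_continuous (continuous_circleMap 0 r) (circleMap_mem_unit_ball hr₀ hr₁)

theorem periodic_slice (u : ℂ → ℝ) (r : ℝ) : Function.Periodic (slice u r) (2 * π) := by
  rw [slice_eq_comp_circleMap]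
  exact (periodic_circleMap 0 r).comp u

theorem abs_integral_slice_le_hkNorm {u : ℂ → ℝ} (hu : hkNorm u < ∞) {r : ℝ} (hr₀ : 0 ≤ r)
    (hr₁ : r < 1) {a b : ℝ} (hab : a ≤ b) (hlen : b - a ≤ 2 * π) :
    |∫ t in a..b, slice u r t| ≤ (hkNorm u).toReal := by
  rw [← ENNReal.ofReal_le_iff_le_toReal hu.ne]
  calc ENNReal.ofReal |∫ t in a..b, slice u r t| ≤ alexiewiczNorm (slice u r) :=
        le_iSup₂_of_le a b (le_iSup_of_le ⟨hab, hlen⟩ le_rfl)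
    _ ≤ hkNorm u :=
        le_iSup₂ (f := fun r (_ : 0 ≤ r ∧ r < 1) => alexiewiczNorm (slice u r)) r ⟨hr₀, hr₁⟩

theorem mem_harmonicHardyHK_of_abs_integral_le {u : ℂ → ℝ} (hu : HarmonicOnNhd u (ball 0 1))
    {C : ℝ} (hC : ∀ r, 0 ≤ r → r < 1 → ∀ a b, a ≤ b → b - a ≤ 2 * π →
      |∫ t in a..b, slice u r t| ≤ C) : u ∈ harmonicHardyHK := by
  have hnorm : hkNorm u ≤ ENNReal.ofReal C :=
    iSup₂_le fun r hr => iSup₂_le fun a b => iSup_le fun hab =>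
      ENNReal.ofReal_le_ofReal (hC r hr.1 hr.2 a b hab.1 hab.2)
  exact ⟨hu, hnorm.trans_lt ENNReal.ofReal_lt_top⟩

/-! ### Integration against an even kernel decreasing away from the origin -/

section EvenKernel

variable {E : Type*} [NormedAddCommGroup E] [NormedSpace ℝ E] {f : ℝ → E}

theorem hasDerivAt_integral_neg_self [CompleteSpace E] (hf : Continuous f) (x : ℝ) :
    HasDerivAt (fun y => ∫ t in (-y)..y, f t) (f x + f (-x)) x := by
  have hprim (y : ℝ) : HasDerivAt (fun y => ∫ t in 0..y, f t) (f y) y :=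
    intervalIntegral.integral_hasDerivAt_right (hf.intervalIntegrable _ _)
      (hf.stronglyMeasurableAtFilter _ _) hf.continuousAt
  have hsplit : (fun y => ∫ t in (-y)..y, f t) =
      fun y => (∫ t in 0..y, f t) - ∫ t in 0..(-y), f t := by
    funext y
    rw [intervalIntegral.integral_interval_sub_left] <;> exact hf.intervalIntegrable _ _
  rw [hsplit]
  refine ((hprim x).sub ((hprim (-x)).scomp x (hasDerivAt_neg x))).congr_deriv ?_
  rw [neg_smul, one_smul, sub_neg_eq_add]

theorem integral_neg_self_smul_of_even {P : ℝ → ℝ} (hP : Continuous P)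
    (heven : Function.Even P) (hf : Continuous f) (c : ℝ) :
    ∫ x in (-c)..c, P x • f x = ∫ x in 0..c, P x • (f x + f (-x)) := by
  have hreflect : ∫ x in (-c)..0, P x • f x = ∫ x in 0..c, P x • f (-x) := by
    simpa only [heven _, neg_zero] using
      (intervalIntegral.integral_comp_neg (a := 0) (b := c) fun x => P x • f x).symm
  have hPf : Continuous fun x => P x • f x := hP.smul hf
  have hPf_neg : Continuous fun x => P x • f (-x) := hP.smul (hf.comp continuous_neg)
  rw [← intervalIntegral.integral_add_adjacent_intervals (hPf.intervalIntegrable (-c) 0)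
    (hPf.intervalIntegrable 0 c), hreflect, add_comm, ← intervalIntegral.integral_add
    (hPf.intervalIntegrable 0 c) (hPf_neg.intervalIntegrable 0 c)]
  simp only [smul_add]

theorem norm_integral_deriv_smul_le_of_deriv_nonpos {P P' : ℝ → ℝ} {G : ℝ → E} {a b A : ℝ}
    (hab : a ≤ b) (hP : ∀ x ∈ Icc a b, HasDerivAt P (P' x) x)
    (hP' : IntervalIntegrable P' volume a b) (hneg : ∀ x ∈ Icc a b, P' x ≤ 0)
    (hG : ∀ x ∈ Icc a b, ‖G x‖ ≤ A) :
    ‖∫ x in a..b, P' x • G x‖ ≤ (P a - P b) * A := by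
  have hderiv : ∫ x in a..b, P' x = P b - P a :=
    intervalIntegral.integral_eq_sub_of_hasDerivAt (by rwa [uIcc_of_le hab]) hP'
  calc ‖∫ x in a..b, P' x • G x‖ ≤ ∫ x in a..b, -P' x * A := by
        refine intervalIntegral.norm_integral_le_of_norm_le hab
          (ae_of_all _ fun x hx => ?_) (hP'.neg.mul_const A)
        have hx' := Ioc_subset_Icc_self hx
        rw [norm_smul, Real.norm_of_nonpos (hneg x hx')]
        exact mul_le_mul_of_nonneg_left (hG x hx') (neg_nonneg.2 (hneg x hx'))
    _ = (P a - P b) * A := by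
        rw [intervalIntegral.integral_mul_const, intervalIntegral.integral_neg, hderiv, neg_sub]

theorem norm_integral_smul_le_of_even_of_deriv_nonpos [CompleteSpace E] {P P' : ℝ → ℝ}
    {c A : ℝ} (hc : 0 ≤ c) (hP : ∀ x, HasDerivAt P (P' x) x) (hP' : Continuous P')
    (heven : Function.Even P) (hneg : ∀ x ∈ Icc 0 c, P' x ≤ 0) (hPc : 0 ≤ P c)
    (hf : Continuous f) (hA : ∀ x ∈ Icc 0 c, ‖∫ t in (-x)..x, f t‖ ≤ A) :
    ‖∫ x in (-c)..c, P x • f x‖ ≤ P 0 * A := by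
  have hPcont : Continuous P := continuous_iff_continuousAt.2 fun x => (hP x).continuousAt
  set G : ℝ → E := fun x => ∫ t in (-x)..x, f t
  have hparts : ∫ x in (-c)..c, P x • f x = P c • G c - ∫ x in 0..c, P' x • G x := by
    rw [integral_neg_self_smul_of_even hPcont heven hf,
      intervalIntegral.integral_smul_deriv_eq_deriv_smul (fun x _ => hP x)
        (fun x _ => hasDerivAt_integral_neg_self hf x) (hP'.intervalIntegrable _ _)
        ((hf.add (hf.comp continuous_neg)).intervalIntegrable _ _)]
    simp only [G, neg_zero, intervalIntegral.integral_same, smul_zero, sub_zero]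
  have hboundary : ‖P c • G c‖ ≤ P c * A := by
    rw [norm_smul, Real.norm_of_nonneg hPc]
    exact mul_le_mul_of_nonneg_left (hA c ⟨hc, le_rfl⟩) hPc
  have hinterior : ‖∫ x in 0..c, P' x • G x‖ ≤ (P 0 - P c) * A :=
    norm_integral_deriv_smul_le_of_deriv_nonpos hc (fun x _ => hP x)
      (hP'.intervalIntegrable _ _) hneg hA
  calc ‖∫ x in (-c)..c, P x • f x‖ ≤ ‖P c • G c‖ + ‖∫ x in 0..c, P' x • G x‖ := by
        rw [hparts]
        exact norm_sub_le _ _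
    _ ≤ P c * A + (P 0 - P c) * A := add_le_add hboundary hinterior
    _ = P 0 * A := by ring

end EvenKernel

/-! ### Pointwise growth -/

/-- The Poisson kernel of the disc of radius `s`, for a point at distance `r` from the centre, as
a function of the angle `x` between that point and the point of the bounding circle. -/
noncomputable def polarPoissonKernel (s r x : ℝ) : ℝ :=
  (s ^ 2 - r ^ 2) / (s ^ 2 - 2 * s * r * Real.cos x + r ^ 2)

section PolarPoissonKernel

variable {s r : ℝ}

theorem polarPoissonKernel_denom_pos (hr : 0 ≤ r) (hrs : r < s) (x : ℝ) :
    0 < s ^ 2 - 2 * s * r * Real.cos x + r ^ 2 := by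
  nlinarith [mul_le_mul_of_nonneg_left (Real.cos_le_one x) (mul_nonneg (hr.trans hrs.le) hr),
    pow_pos (sub_pos.2 hrs) 2]

theorem polarPoissonKernel_nonneg (hr : 0 ≤ r) (hrs : r < s) (x : ℝ) :
    0 ≤ polarPoissonKernel s r x :=
  div_nonneg (sub_nonneg.2 (pow_le_pow_left₀ hr hrs.le 2))
    (polarPoissonKernel_denom_pos hr hrs x).le

theorem even_polarPoissonKernel (s r : ℝ) : Function.Even (polarPoissonKernel s r) := fun x => by
  simp only [polarPoissonKernel, Real.cos_neg]

theorem polarPoissonKernel_zero (hrs : r < s) : polarPoissonKernel s r 0 = (s + r) / (s - r) := by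
  have hsub : s - r ≠ 0 := (sub_pos.2 hrs).ne'
  rw [polarPoissonKernel, Real.cos_zero,
    show s ^ 2 - 2 * s * r * 1 + r ^ 2 = (s - r) * (s - r) by ring,
    show s ^ 2 - r ^ 2 = (s + r) * (s - r) by ring, mul_div_mul_right _ _ hsub]

theorem hasDerivAt_polarPoissonKernel (hr : 0 ≤ r) (hrs : r < s) (x : ℝ) :
    HasDerivAt (polarPoissonKernel s r)
      (-((s ^ 2 - r ^ 2) * (2 * s * r * Real.sin x)) /
        (s ^ 2 - 2 * s * r * Real.cos x + r ^ 2) ^ 2) x := by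
  have hdenom : HasDerivAt (fun x => s ^ 2 - 2 * s * r * Real.cos x + r ^ 2)
      (2 * s * r * Real.sin x) x := by
    refine ((((Real.hasDerivAt_cos x).const_mul (2 * s * r)).const_sub (s ^ 2)).add_const
      (r ^ 2)).congr_deriv ?_
    ring
  refine ((hasDerivAt_const x (s ^ 2 - r ^ 2)).div hdenom
    (polarPoissonKernel_denom_pos hr hrs x).ne').congr_deriv ?_
  ring

theorem norm_integral_polarPoissonKernel_smul_le {E : Type*} [NormedAddCommGroup E]
    [NormedSpace ℝ E] [CompleteSpace E] {f : ℝ → E} {A : ℝ} (hr : 0 ≤ r) (hrs : r < s)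
    (hf : Continuous f) (hA : ∀ x ∈ Icc 0 π, ‖∫ t in (-x)..x, f t‖ ≤ A) :
    ‖∫ x in (-π)..π, polarPoissonKernel s r x • f x‖ ≤ (s + r) / (s - r) * A := by
  have hs : 0 ≤ s := hr.trans hrs.le
  rw [← polarPoissonKernel_zero hrs]
  refine norm_integral_smul_le_of_even_of_deriv_nonpos Real.pi_pos.le
    (hasDerivAt_polarPoissonKernel hr hrs) ?_ (even_polarPoissonKernel s r) (fun x hx => ?_)
    (polarPoissonKernel_nonneg hr hrs π) hf hA
  · exact Continuous.div (by fun_prop) (by fun_prop) fun x =>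
      pow_ne_zero 2 (polarPoissonKernel_denom_pos hr hrs x).ne'
  · have hsin : 0 ≤ Real.sin x := Real.sin_nonneg_of_mem_Icc hx
    have hsq : 0 ≤ s ^ 2 - r ^ 2 := sub_nonneg.2 (pow_le_pow_left₀ hr hrs.le 2)
    exact div_nonpos_of_nonpos_of_nonneg (neg_nonpos.2 (by positivity)) (sq_nonneg _)

theorem poissonKernel_circleMap_circleMap (s r t θ : ℝ) :
    poissonKernel 0 (circleMap 0 r θ) (circleMap 0 s t) = polarPoissonKernel s r (t - θ) := by
  have hdist : ‖circleMap 0 s t - circleMap 0 r θ‖ ^ 2 =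
      s ^ 2 - 2 * s * r * Real.cos (t - θ) + r ^ 2 := by
    rw [← Complex.normSq_eq_norm_sq, Complex.normSq_apply, Complex.sub_re, Complex.sub_im]
    simp only [circleMap_zero_re, circleMap_zero_im]
    rw [Real.cos_sub]
    linear_combination s ^ 2 * Real.sin_sq_add_cos_sq t + r ^ 2 * Real.sin_sq_add_cos_sq θ
  rw [poissonKernel_def, sub_zero, sub_zero, norm_circleMap_zero, norm_circleMap_zero, sq_abs,
    sq_abs, hdist, polarPoissonKernel]

theorem slice_eq_integral_polarPoissonKernel_mul {u : ℂ → ℝ}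
    (hu : HarmonicOnNhd u (closedBall 0 s)) (hr : 0 ≤ r) (hrs : r < s) (θ : ℝ) :
    slice u r θ = (2 * π)⁻¹ * ∫ x in (-π)..π, polarPoissonKernel s r x * slice u s (x + θ) := by
  set g : ℝ → ℝ := fun t => polarPoissonKernel s r (t - θ) * slice u s t with hg
  have hg_periodic : Function.Periodic g (2 * π) := fun t => by
    simp only [hg, polarPoissonKernel]
    rw [periodic_slice u s t, add_sub_right_comm, Real.cos_add_two_pi]
  have hball : circleMap 0 r θ ∈ ball (0 : ℂ) s := by
    rwa [mem_ball_zero_iff, norm_circleMap_zero, abs_of_nonneg hr]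
  calc slice u r θ = Real.circleAverage (poissonKernel 0 (circleMap 0 r θ) • u) 0 s := by
        rw [hu.circleAverage_poissonKernel_smul hball, slice_eq_comp_circleMap,
          Function.comp_apply]
    _ = (2 * π)⁻¹ * ∫ t in 0..(2 * π), g t := by
        simp only [Real.circleAverage_def, smul_eq_mul, Pi.mul_apply,
          poissonKernel_circleMap_circleMap, hg, slice_eq_comp_circleMap, Function.comp_apply]
    _ = (2 * π)⁻¹ * ∫ t in (-π + θ)..(π + θ), g t := by
        have hshift := hg_periodic.intervalIntegral_add_eq 0 (-π + θ)
        rw [zero_add, show -π + θ + 2 * π = π + θ by ring] at hshift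
        rw [hshift]
    _ = (2 * π)⁻¹ * ∫ x in (-π)..π, polarPoissonKernel s r x * slice u s (x + θ) := by
        rw [← intervalIntegral.integral_comp_add_right g θ]
        simp only [hg, add_sub_cancel_right]

end PolarPoissonKernel

theorem abs_slice_le_of_lt_of_lt_one {u : ℂ → ℝ} (hu : u ∈ harmonicHardyHK) {r s : ℝ}
    (hr : 0 ≤ r) (hrs : r < s) (hs : s < 1) (θ : ℝ) :
    |slice u r θ| ≤ (2 * π)⁻¹ * ((s + r) / (s - r) * (hkNorm u).toReal) := by
  have hs₀ : 0 ≤ s := hr.trans hrs.le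
  have hcont : Continuous fun x => slice u s (x + θ) :=
    (continuous_slice hu.1.continuousOn hs₀ hs).comp (continuous_add_const θ)
  rw [slice_eq_integral_polarPoissonKernel_mul (hu.1.mono (closedBall_subset_ball hs)) hr hrs,
    abs_mul, abs_of_pos (inv_pos.2 Real.two_pi_pos)]
  refine mul_le_mul_of_nonneg_left ?_ (inv_nonneg.2 Real.two_pi_pos.le)
  refine norm_integral_polarPoissonKernel_smul_le hr hrs hcont fun x hx => ?_
  rw [intervalIntegral.integral_comp_add_right]
  exact abs_integral_slice_le_hkNorm hu.2 hs₀ hs (by linarith [hx.1]) (by linarith [hx.2])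

theorem abs_slice_le {u : ℂ → ℝ} (hu : u ∈ harmonicHardyHK) {r : ℝ} (hr₀ : 0 ≤ r) (hr₁ : r < 1)
    (θ : ℝ) : |slice u r θ| ≤ (2 * π)⁻¹ * ((1 + r) / (1 - r) * (hkNorm u).toReal) := by
  have hlim : Tendsto (fun s => (2 * π)⁻¹ * ((s + r) / (s - r) * (hkNorm u).toReal)) (𝓝[<] 1)
      (𝓝 ((2 * π)⁻¹ * ((1 + r) / (1 - r) * (hkNorm u).toReal))) := by
    have hsub : (1 : ℝ) - r ≠ 0 := (sub_pos.2 hr₁).ne'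
    refine ContinuousAt.tendsto ?_ |>.mono_left nhdsWithin_le_nhds
    fun_prop (disch := exact hsub)
  refine ge_of_tendsto hlim ?_
  filter_upwards [Ioo_mem_nhdsLT hr₁] with s hs
  exact abs_slice_le_of_lt_of_lt_one hu hr₀ hs.1 hs.2 θ

/-! ### Growth of the `L^p` norms -/

theorem ofReal_periodFactor (p : ℝ≥0∞) :
    ENNReal.ofReal (periodFactor p) = ENNReal.ofReal (2 * π) ^ p.toReal⁻¹ := by
  rw [periodFactor]
  split_ifs with hp
  · simp [hp]
  · rw [ENNReal.ofReal_rpow_of_pos Real.two_pi_pos, one_div]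

theorem periodFactor_nonneg (p : ℝ≥0∞) : 0 ≤ periodFactor p := by
  unfold periodFactor
  split_ifs <;> positivity

theorem volume_Ioc_neg_pi_pi : volume (Ioc (-π) π) = ENNReal.ofReal (2 * π) := by
  rw [Real.volume_Ioc, sub_neg_eq_add, two_mul]

theorem sliceLpNorm_le_of_abs_le {u : ℂ → ℝ} {r C : ℝ} (hC : ∀ θ, |slice u r θ| ≤ C)
    (p : ℝ≥0∞) : sliceLpNorm u p r ≤ ENNReal.ofReal (periodFactor p) * ENNReal.ofReal C := by
  rw [ofReal_periodFactor, ← volume_Ioc_neg_pi_pi, ← Measure.restrict_apply_univ]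
  exact eLpNorm_le_of_ae_bound (ae_of_all _ hC)

theorem sliceLpNorm_le_of_constant_le {u : ℂ → ℝ} (hu : u ∈ harmonicHardyHK) (p : ℝ≥0∞)
    {r K : ℝ} (hr₀ : 0 ≤ r) (hr₁ : r < 1) (hK : (1 + r) / (2 * π * (1 - r)) ≤ K) :
    sliceLpNorm u p r ≤ ENNReal.ofReal (periodFactor p * K) * hkNorm u := by
  have hsub : 0 < 1 - r := sub_pos.2 hr₁
  have hK₀ : 0 ≤ K := le_trans (by positivity) hK
  have hpointwise (θ : ℝ) : |slice u r θ| ≤ K * (hkNorm u).toReal :=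
    calc |slice u r θ| ≤ (2 * π)⁻¹ * ((1 + r) / (1 - r) * (hkNorm u).toReal) :=
          abs_slice_le hu hr₀ hr₁ θ
      _ = (1 + r) / (2 * π * (1 - r)) * (hkNorm u).toReal := by field_simp
      _ ≤ K * (hkNorm u).toReal := mul_le_mul_of_nonneg_right hK ENNReal.toReal_nonneg
  calc sliceLpNorm u p r
      ≤ ENNReal.ofReal (periodFactor p) * ENNReal.ofReal (K * (hkNorm u).toReal) :=
        sliceLpNorm_le_of_abs_le hpointwise p
    _ = ENNReal.ofReal (periodFactor p * K) * hkNorm u := by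
        rw [ENNReal.ofReal_mul hK₀, ENNReal.ofReal_toReal hu.2.ne,
          ENNReal.ofReal_mul (periodFactor_nonneg p), mul_assoc]

theorem sliceLpNorm_le_of_half_le {u : ℂ → ℝ} (hu : u ∈ harmonicHardyHK) (p : ℝ≥0∞) {r : ℝ}
    (hr : 1 / 2 ≤ r) (hr₁ : r < 1) :
    sliceLpNorm u p r ≤ ENNReal.ofReal (periodFactor p * (2 * r / (π * (1 - r)))) * hkNorm u := by
  refine sliceLpNorm_le_of_constant_le hu p (by linarith) hr₁ ?_
  have := sub_pos.2 hr₁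
  rw [mul_assoc, ← div_div]
  gcongr
  linarith

theorem sliceLpNorm_le_of_le_half {u : ℂ → ℝ} (hu : u ∈ harmonicHardyHK) (p : ℝ≥0∞) {r : ℝ}
    (hr₀ : 0 ≤ r) (hr : r ≤ 1 / 2) :
    sliceLpNorm u p r ≤ ENNReal.ofReal (periodFactor p * (2 / π)) * hkNorm u := by
  refine sliceLpNorm_le_of_constant_le hu p hr₀ (by linarith) ?_
  have hsub : 0 < 1 - r := by linarith
  rw [div_le_div_iff₀ (by positivity) Real.pi_pos]
  nlinarith [Real.pi_pos]

/-! ### The Poisson kernel attains the order for `p = ∞` -/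

theorem mem_harmonicHardyHK_of_nonneg {u : ℂ → ℝ} (hu : HarmonicOnNhd u (ball 0 1))
    (hnonneg : ∀ z ∈ ball (0 : ℂ) 1, 0 ≤ u z) : u ∈ harmonicHardyHK := by
  refine mem_harmonicHardyHK_of_abs_integral_le hu (C := 2 * π * u 0)
    fun r hr₀ hr₁ a b hab hlen => ?_
  have hslice (t : ℝ) : 0 ≤ slice u r t := by
    rw [slice_eq_comp_circleMap]
    exact hnonneg _ (circleMap_mem_unit_ball hr₀ hr₁ t)
  have hmean : Real.circleAverage u 0 r = u 0 :=
    (hu.mono (closedBall_subset_ball (by rwa [abs_of_nonneg hr₀]))).circleAverage_eq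
  calc |∫ t in a..b, slice u r t| = ∫ t in a..b, slice u r t :=
        abs_of_nonneg (intervalIntegral.integral_nonneg hab fun t _ => hslice t)
    _ ≤ ∫ t in a..(a + 2 * π), slice u r t :=
        intervalIntegral.integral_mono_interval le_rfl hab (by linarith) (ae_of_all _ hslice)
          ((continuous_slice hu.continuousOn hr₀ hr₁).intervalIntegrable _ _)
    _ = ∫ t in 0..(2 * π), slice u r t := by
        rw [(periodic_slice u r).intervalIntegral_add_eq a 0, zero_add]
    _ = 2 * π * u 0 := by
        rw [← hmean, Real.circleAverage_def, smul_eq_mul,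
          mul_inv_cancel_left₀ Real.two_pi_pos.ne', slice_eq_comp_circleMap]
        rfl

theorem harmonicOnNhd_re {F : ℂ → ℂ} {s : Set ℂ} (hs : IsOpen s) (hF : DifferentiableOn ℂ F s) :
    HarmonicOnNhd (fun z => (F z).re) s :=
  fun _ hz => (hF.analyticAt (hs.mem_nhds hz)).harmonicAt_re

theorem harmonicOnNhd_poissonKernel_left (c : ℂ) {R : ℝ} {ζ : ℂ} (hζ : ζ ∈ sphere c R) :
    HarmonicOnNhd (fun z => poissonKernel c z ζ) (ball c R) := by
  simp only [poissonKernel_eq_re_herglotzRieszKernel, Function.comp_apply, herglotzRieszKernel_def]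
  refine harmonicOnNhd_re isOpen_ball (DifferentiableOn.div (by fun_prop) (by fun_prop) ?_)
  intro z hz hzero
  rw [sub_sub_sub_cancel_right, sub_eq_zero] at hzero
  exact (mem_ball.1 (hzero ▸ hz)).ne (mem_sphere.1 hζ)

theorem poissonKernel_nonneg {c z ζ : ℂ} {R : ℝ} (hz : z ∈ ball c R) (hζ : ζ ∈ sphere c R) :
    0 ≤ poissonKernel c z ζ := by
  rw [mem_ball_iff_norm] at hz
  rw [mem_sphere_iff_norm] at hζ
  rw [poissonKernel_def, hζ]
  exact div_nonneg (sub_nonneg.2 (pow_le_pow_left₀ (norm_nonneg _) hz.le 2)) (sq_nonneg _)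

theorem poissonKernel_one_mem_harmonicHardyHK :
    (fun z => poissonKernel 0 z 1) ∈ harmonicHardyHK := by
  have hone : (1 : ℂ) ∈ sphere (0 : ℂ) 1 := by simp
  exact mem_harmonicHardyHK_of_nonneg (harmonicOnNhd_poissonKernel_left 0 hone)
    fun z hz => poissonKernel_nonneg hz hone

theorem slice_poissonKernel_one_zero {r : ℝ} (hr : r < 1) :
    slice (fun z => poissonKernel 0 z 1) r 0 = (1 + r) / (1 - r) := by
  have hone : (1 : ℂ) = circleMap 0 1 0 := by simp [circleMap]
  rw [slice_eq_comp_circleMap, Function.comp_apply, hone, poissonKernel_circleMap_circleMap,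
    sub_zero, polarPoissonKernel_zero hr]

theorem enorm_le_eLpNorm_top_restrict {X E : Type*} [TopologicalSpace X] [MeasurableSpace X]
    [OpensMeasurableSpace X] [TopologicalSpace E] [ContinuousENorm E] {μ : Measure X}
    [μ.IsOpenPosMeasure] {f : X → E} (hf : Continuous f) {s : Set X} {x : X}
    (hx : x ∈ interior s) : ‖f x‖ₑ ≤ eLpNorm f ∞ (μ.restrict s) := by
  by_contra! hlt
  set U : Set X := {y | eLpNorm f ∞ (μ.restrict s) < ‖f y‖ₑ}
  have hU : IsOpen U := isOpen_lt continuous_const hf.enorm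
  have hU_null : μ (U ∩ s) = 0 := by
    rw [← Measure.restrict_apply hU.measurableSet]
    exact meas_eLpNormEssSup_lt
  have hpos : 0 < μ (U ∩ interior s) := (hU.inter isOpen_interior).measure_pos μ ⟨x, hlt, hx⟩
  exact hpos.ne' (measure_mono_null (inter_subset_inter_right U interior_subset) hU_null)

theorem exists_ofReal_div_one_sub_le_sliceLpNorm_top :
    ∃ u ∈ harmonicHardyHK, ∃ c : ℝ, 0 < c ∧ ∀ r : ℝ, 0 ≤ r → r < 1 →
      ENNReal.ofReal (c / (1 - r)) ≤ sliceLpNorm u ∞ r := by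
  refine ⟨_, poissonKernel_one_mem_harmonicHardyHK, 1, one_pos, fun r hr₀ hr₁ => ?_⟩
  set u : ℂ → ℝ := fun z => poissonKernel 0 z 1
  have hcont : Continuous (slice u r) :=
    continuous_slice poissonKernel_one_mem_harmonicHardyHK.1.continuousOn hr₀ hr₁
  have hzero : (0 : ℝ) ∈ interior (Ioc (-π) π) := by
    rw [interior_Ioc]
    exact ⟨neg_lt_zero.2 Real.pi_pos, Real.pi_pos⟩
  calc ENNReal.ofReal (1 / (1 - r)) ≤ ENNReal.ofReal (slice u r 0) := by
        rw [slice_poissonKernel_one_zero hr₁]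
        exact ENNReal.ofReal_le_ofReal
          (div_le_div_of_nonneg_right (by linarith) (sub_pos.2 hr₁).le)
    _ ≤ ‖slice u r 0‖ₑ := Real.ofReal_le_enorm _
    _ ≤ sliceLpNorm u ∞ r := enorm_le_eLpNorm_top_restrict hcont hzero

/-! ### Sharpness of the order for every `p ≥ 1` -/

theorem exists_natCast_mul_pow_le {ρ : ℝ} (hρ₀ : 0 ≤ ρ) (hρ₁ : ρ < 1) :
    ∃ C : ℝ, ∀ n : ℕ, n * ρ ^ n ≤ C := by
  have hsum : Summable fun n : ℕ => (n : ℝ) * ρ ^ n := by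
    simpa only [pow_one] using summable_pow_mul_geometric_of_norm_lt_one 1 (R := ℝ) (r := ρ)
      (by rwa [Real.norm_of_nonneg hρ₀])
  exact ⟨_, fun n => hsum.le_tsum n fun m _ => by positivity⟩

/-- The series `∑ bₖ nₖ z ^ nₖ`, that is `z` times the derivative of `∑ bₖ z ^ nₖ`. Its real part
at `r e ^ (iθ)` is the `θ`-derivative of `∑ bₖ r ^ nₖ sin (nₖ θ)`, which stays bounded as `r → 1`
when `b` is summable. -/
noncomputable def gapSeries {ι : Type*} (b : ι → ℝ) (n : ι → ℕ) (z : ℂ) : ℂ :=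
  ∑' k, (b k : ℂ) * (n k * z ^ n k)

section GapSeries

variable {ι : Type*} {b : ι → ℝ} {r : ℝ}

theorem norm_gapSeries_term (b : ι → ℝ) (n : ι → ℕ) (k : ι) (z : ℂ) :
    ‖(b k : ℂ) * (n k * z ^ n k)‖ = |b k| * (n k * ‖z‖ ^ n k) := by
  rw [norm_mul, norm_mul, norm_pow, Complex.norm_real, Real.norm_eq_abs, Complex.norm_natCast]

theorem summable_abs_mul_natCast_mul_pow (hb : Summable b) (n : ι → ℕ) (hr₀ : 0 ≤ r)
    (hr₁ : r < 1) : Summable fun k => |b k| * (n k * r ^ n k) := by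
  obtain ⟨C, hC⟩ := exists_natCast_mul_pow_le hr₀ hr₁
  exact Summable.of_nonneg_of_le (fun k => by positivity)
    (fun k => mul_le_mul_of_nonneg_left (hC (n k)) (abs_nonneg _)) (hb.abs.mul_right C)

theorem differentiableOn_gapSeries (hb : Summable b) (n : ι → ℕ) :
    DifferentiableOn ℂ (gapSeries b n) (ball 0 1) := by
  intro z hz
  obtain ⟨ρ, hzρ, hρ⟩ := exists_between (mem_ball_zero_iff.1 hz)
  have hdiff : DifferentiableOn ℂ (gapSeries b n) (ball 0 ρ) := by
    refine Complex.differentiableOn_tsum_of_summable_norm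
      (summable_abs_mul_natCast_mul_pow hb n ((norm_nonneg z).trans hzρ.le) hρ)
      (fun k => by fun_prop) isOpen_ball fun k w hw => ?_
    rw [norm_gapSeries_term]
    gcongr
    exact (mem_ball_zero_iff.1 hw).le
  exact (hdiff.differentiableAt
    (isOpen_ball.mem_nhds (mem_ball_zero_iff.2 hzρ))).differentiableWithinAt

theorem hasSum_slice_gapSeries (hb : Summable b) (n : ι → ℕ) (hr₀ : 0 ≤ r) (hr₁ : r < 1)
    (θ : ℝ) :
    HasSum (fun k => b k * (n k * r ^ n k) * Real.cos (n k * θ))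
      (slice (fun z => (gapSeries b n z).re) r θ) := by
  have hsum : Summable fun k => (b k : ℂ) * (n k * circleMap 0 r θ ^ n k) := by
    refine Summable.of_norm ?_
    simp only [norm_gapSeries_term, norm_circleMap_zero, abs_of_nonneg hr₀]
    exact summable_abs_mul_natCast_mul_pow hb n hr₀ hr₁
  have hterm (k : ι) : ((b k : ℂ) * (n k * circleMap 0 r θ ^ n k)).re =
      b k * (n k * r ^ n k) * Real.cos (n k * θ) := by
    rw [circleMap_zero_pow, ← Complex.ofReal_natCast, Complex.re_ofReal_mul,
      Complex.re_ofReal_mul, circleMap_zero_re]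
    ring
  rw [slice_eq_comp_circleMap]
  simpa only [hterm, Function.comp_apply, gapSeries] using Complex.hasSum_re hsum.hasSum

theorem hasSum_integral_slice_gapSeries_mul [Countable ι] (hb : Summable b) (n : ι → ℕ)
    (hr₀ : 0 ≤ r) (hr₁ : r < 1) {g : ℝ → ℝ} (hg : Continuous g) (hg_le : ∀ x, |g x| ≤ 1)
    (a c : ℝ) :
    HasSum (fun k => b k * (n k * r ^ n k) * ∫ x in a..c, Real.cos (n k * x) * g x)
      (∫ x in a..c, slice (fun z => (gapSeries b n z).re) r x * g x) := by
  have hbound (k : ι) (x : ℝ) :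
      ‖b k * (n k * r ^ n k) * Real.cos (n k * x) * g x‖ ≤ |b k| * (n k * r ^ n k) := by
    rw [Real.norm_eq_abs, abs_mul, abs_mul, abs_mul, mul_assoc,
      abs_of_nonneg (by positivity : 0 ≤ n k * r ^ n k)]
    exact mul_le_of_le_one_right (by positivity)
      (mul_le_one₀ (Real.abs_cos_le_one _) (abs_nonneg _) (hg_le x))
  have hintegral := intervalIntegral.hasSum_integral_of_dominated_convergence
    (μ := volume) (a := a) (b := c) (fun k _ => |b k| * (n k * r ^ n k))
    (fun k => (by fun_prop : Continuous fun x =>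
      b k * (n k * r ^ n k) * Real.cos (n k * x) * g x).aestronglyMeasurable)
    (fun k => ae_of_all _ fun x _ => hbound k x)
    (ae_of_all _ fun _ _ => summable_abs_mul_natCast_mul_pow hb n hr₀ hr₁)
    intervalIntegrable_const
    (ae_of_all _ fun x _ => (hasSum_slice_gapSeries hb n hr₀ hr₁ x).mul_right _)
  simpa only [mul_assoc, intervalIntegral.integral_const_mul] using hintegral

theorem natCast_mul_abs_integral_cos_le (n : ℕ) (a c : ℝ) :
    n * |∫ x in a..c, Real.cos (n * x)| ≤ 2 := by
  rcases eq_or_ne n 0 with rfl | hn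
  · simp
  · have hn' : (n : ℝ) ≠ 0 := Nat.cast_ne_zero.2 hn
    rw [intervalIntegral.integral_comp_mul_left _ hn', integral_cos, smul_eq_mul, abs_mul,
      abs_of_nonneg (by positivity), mul_inv_cancel_left₀ hn']
    linarith [abs_sub (Real.sin (n * c)) (Real.sin (n * a)), Real.abs_sin_le_one (n * c),
      Real.abs_sin_le_one (n * a)]

theorem re_gapSeries_mem_harmonicHardyHK [Countable ι] (hb : Summable b) (n : ι → ℕ) :
    (fun z => (gapSeries b n z).re) ∈ harmonicHardyHK := by
  refine mem_harmonicHardyHK_of_abs_integral_le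
    (harmonicOnNhd_re isOpen_ball (differentiableOn_gapSeries hb n)) (C := ∑' k, |b k| * 2)
    fun r hr₀ hr₁ a c _ _ => ?_
  have hsum := hasSum_integral_slice_gapSeries_mul hb n hr₀ hr₁ (g := fun _ => 1)
    continuous_const (fun _ => abs_one.le) a c
  simp only [mul_one] at hsum
  rw [← hsum.tsum_eq, ← Real.norm_eq_abs]
  refine tsum_of_norm_bounded (hb.abs.mul_right 2).hasSum fun k => ?_
  calc ‖b k * (n k * r ^ n k) * ∫ x in a..c, Real.cos (n k * x)‖
      = |b k| * (r ^ n k * (n k * |∫ x in a..c, Real.cos (n k * x)|)) := by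
        rw [Real.norm_eq_abs, abs_mul, abs_mul,
          abs_of_nonneg (by positivity : 0 ≤ n k * r ^ n k)]
        ring
    _ ≤ |b k| * (1 * 2) := by
        gcongr
        exacts [pow_le_one₀ hr₀ hr₁.le, natCast_mul_abs_integral_cos_le _ _ _]
    _ = |b k| * 2 := by rw [one_mul]

theorem integral_cos_intCast_mul_nonneg (j : ℤ) : 0 ≤ ∫ x in (-π)..π, Real.cos (j * x) := by
  rcases eq_or_ne j 0 with rfl | hj
  · simp [Real.pi_pos.le]
  · rw [intervalIntegral.integral_comp_mul_left _ (Int.cast_ne_zero.2 hj), integral_cos]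
    simp [Real.sin_int_mul_pi]

theorem integral_cos_mul_cos (n m : ℤ) :
    ∫ x in (-π)..π, Real.cos (n * x) * Real.cos (m * x) =
      ((∫ x in (-π)..π, Real.cos ((n - m : ℤ) * x)) +
        ∫ x in (-π)..π, Real.cos ((n + m : ℤ) * x)) / 2 := by
  rw [← intervalIntegral.integral_add (Continuous.intervalIntegrable (by fun_prop) _ _)
    (Continuous.intervalIntegrable (by fun_prop) _ _), ← intervalIntegral.integral_div]
  refine intervalIntegral.integral_congr fun x _ => ?_
  push_cast
  rw [sub_mul, add_mul, Real.cos_sub, Real.cos_add]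
  ring

theorem integral_cos_mul_cos_nonneg (n m : ℤ) :
    0 ≤ ∫ x in (-π)..π, Real.cos (n * x) * Real.cos (m * x) := by
  rw [integral_cos_mul_cos]
  exact div_nonneg (add_nonneg (integral_cos_intCast_mul_nonneg _)
    (integral_cos_intCast_mul_nonneg _)) zero_le_two

theorem pi_le_integral_cos_mul_cos_self (n : ℤ) :
    π ≤ ∫ x in (-π)..π, Real.cos (n * x) * Real.cos (n * x) := by
  have hconst : ∫ x in (-π)..π, Real.cos ((n - n : ℤ) * x) = 2 * π := by
    simp [two_mul]
  rw [integral_cos_mul_cos, hconst]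
  linarith [integral_cos_intCast_mul_nonneg (n + n)]

theorem le_integral_slice_gapSeries_mul_cos [Countable ι] (hb₀ : ∀ k, 0 ≤ b k)
    (hb : Summable b) (n : ι → ℕ) (hr₀ : 0 ≤ r) (hr₁ : r < 1) (k : ι) :
    b k * (n k * r ^ n k) * π ≤
      ∫ x in (-π)..π, slice (fun z => (gapSeries b n z).re) r x * Real.cos (n k * x) := by
  have hcoeff (j : ι) : 0 ≤ b j * (n j * r ^ n j) := mul_nonneg (hb₀ j) (by positivity)
  calc b k * (n k * r ^ n k) * π
      ≤ b k * (n k * r ^ n k) * ∫ x in (-π)..π, Real.cos (n k * x) * Real.cos (n k * x) :=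
        mul_le_mul_of_nonneg_left
          (mod_cast pi_le_integral_cos_mul_cos_self (n k)) (hcoeff k)
    _ ≤ ∫ x in (-π)..π, slice (fun z => (gapSeries b n z).re) r x * Real.cos (n k * x) :=
        le_hasSum (hasSum_integral_slice_gapSeries_mul hb n hr₀ hr₁ (by fun_prop)
          (fun _ => Real.abs_cos_le_one _) (-π) π) k fun j _ =>
            mul_nonneg (hcoeff j) (mod_cast integral_cos_mul_cos_nonneg (n j) (n k))

end GapSeries

theorem ofReal_integral_mul_le_eLpNorm_one {X : Type*} [MeasurableSpace X] {μ : Measure X}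
    {f g : X → ℝ} (hg : ∀ x, |g x| ≤ 1) :
    ENNReal.ofReal (∫ x, f x * g x ∂μ) ≤ eLpNorm f 1 μ := by
  rw [eLpNorm_one_eq_lintegral_enorm]
  calc ENNReal.ofReal (∫ x, f x * g x ∂μ) ≤ ‖∫ x, f x * g x ∂μ‖ₑ := Real.ofReal_le_enorm _
    _ ≤ ∫⁻ x, ‖f x * g x‖ₑ ∂μ := enorm_integral_le_lintegral_enorm _
    _ ≤ ∫⁻ x, ‖f x‖ₑ ∂μ := lintegral_mono fun x => by
        rw [enorm_le_iff_norm_le, Real.norm_eq_abs, Real.norm_eq_abs, abs_mul]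
        exact mul_le_of_le_one_right (abs_nonneg _) (hg x)

theorem sliceLpNorm_one_le {u : ℂ → ℝ} {r : ℝ} (hu : Continuous (slice u r)) {p : ℝ≥0∞}
    (hp : 1 ≤ p) : sliceLpNorm u 1 r ≤ sliceLpNorm u p r * ENNReal.ofReal (2 * π) := by
  have hone : 1 ≤ ENNReal.ofReal (2 * π) := ENNReal.one_le_ofReal.2 (by linarith [Real.pi_gt_three])
  calc sliceLpNorm u 1 r
      ≤ sliceLpNorm u p r * ENNReal.ofReal (2 * π) ^ (1 / (1 : ℝ≥0∞).toReal - 1 / p.toReal) := by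
        rw [← volume_Ioc_neg_pi_pi, ← Measure.restrict_apply_univ]
        exact eLpNorm_le_eLpNorm_mul_rpow_measure_univ hp hu.aestronglyMeasurable
    _ ≤ sliceLpNorm u p r * ENNReal.ofReal (2 * π) := by
        gcongr
        exact (ENNReal.rpow_le_rpow_of_exponent_le hone (by simp)).trans_eq (ENNReal.rpow_one _)

theorem ofReal_le_sliceLpNorm_gapSeries {ι : Type*} [Countable ι] {b : ι → ℝ}
    (hb₀ : ∀ k, 0 ≤ b k) (hb : Summable b) (n : ι → ℕ) {r : ℝ} (hr₀ : 0 ≤ r) (hr₁ : r < 1)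
    (k : ι) {p : ℝ≥0∞} (hp : 1 ≤ p) :
    ENNReal.ofReal (b k * (n k * r ^ n k) / 2) ≤
      sliceLpNorm (fun z => (gapSeries b n z).re) p r := by
  set u : ℂ → ℝ := fun z => (gapSeries b n z).re
  have hcont : Continuous (slice u r) :=
    continuous_slice (re_gapSeries_mem_harmonicHardyHK hb n).1.continuousOn hr₀ hr₁
  have htwo_pi : 0 < 2 * π := Real.two_pi_pos
  rw [← ENNReal.mul_le_mul_iff_left (ENNReal.ofReal_pos.2 htwo_pi).ne' ENNReal.ofReal_ne_top]
  calc ENNReal.ofReal (b k * (n k * r ^ n k) / 2) * ENNReal.ofReal (2 * π)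
      = ENNReal.ofReal (b k * (n k * r ^ n k) * π) := by
        rw [← ENNReal.ofReal_mul' htwo_pi.le]
        congr 1
        ring
    _ ≤ ENNReal.ofReal (∫ x in (-π)..π, slice u r x * Real.cos (n k * x)) :=
        ENNReal.ofReal_le_ofReal (le_integral_slice_gapSeries_mul_cos hb₀ hb n hr₀ hr₁ k)
    _ ≤ sliceLpNorm u 1 r := by
        rw [intervalIntegral.integral_of_le (neg_le_self Real.pi_pos.le)]
        exact ofReal_integral_mul_le_eLpNorm_one fun x => Real.abs_cos_le_one (n k * x)
    _ ≤ sliceLpNorm u p r * ENNReal.ofReal (2 * π) := sliceLpNorm_one_le hcont hp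

/-- The radius `1 - 1 / (2n)`, at which `n r ^ n` is comparable with `1 / (1 - r) = 2n`. -/
noncomputable def testRadius (n : ℕ) : ℝ :=
  1 - 1 / (2 * n)

theorem testRadius_mem_Ico {n : ℕ} (hn : 0 < n) : testRadius n ∈ Ico (0 : ℝ) 1 := by
  have hn₁ : (1 : ℝ) ≤ n := Nat.one_le_cast.2 hn
  have hle : 1 / (2 * (n : ℝ)) ≤ 1 := by
    rw [div_le_one (by positivity)]
    linarith
  exact ⟨sub_nonneg.2 hle, sub_lt_self 1 (by positivity)⟩

theorem tendsto_testRadius : Tendsto testRadius atTop (𝓝[<] 1) := by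
  refine tendsto_nhdsWithin_iff.2 ⟨?_, ?_⟩
  · have htop : Tendsto (fun n : ℕ => 2 * (n : ℝ)) atTop atTop :=
      tendsto_natCast_atTop_atTop.const_mul_atTop two_pos
    have hlim := (tendsto_const_nhds (x := (1 : ℝ))).sub (htop.const_div_atTop 1)
    rwa [sub_zero] at hlim
  · filter_upwards [eventually_gt_atTop 0] with n hn
    exact (testRadius_mem_Ico hn).2

theorem half_le_testRadius_pow {n : ℕ} (hn : 0 < n) : 1 / 2 ≤ testRadius n ^ n := by
  have hnonneg := (testRadius_mem_Ico hn).1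
  calc (1 : ℝ) / 2 = 1 + n * (testRadius n - 1) := by
        have hn₀ : (n : ℝ) ≠ 0 := Nat.cast_ne_zero.2 hn.ne'
        rw [testRadius]
        field_simp
        norm_num
    _ ≤ testRadius n ^ n := by
        simpa only [add_sub_cancel] using
          one_add_mul_le_pow (a := testRadius n - 1) (by linarith) n

theorem exists_lt_testRadius_le_mul {ψ : ℝ → ℝ}
    (ho : ψ =o[𝓝[<] (1 : ℝ)] fun r : ℝ => 1 / (1 - r)) {ε : ℝ} (hε : 0 < ε) (N : ℕ) :
    ∃ n : ℕ, N < n ∧ ψ (testRadius n) ≤ ε * n := by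
  have hsmall := tendsto_testRadius.eventually (ho.def (half_pos hε))
  obtain ⟨n, hN, hn⟩ := ((eventually_gt_atTop N).and hsmall).exists
  refine ⟨n, hN, (le_abs_self _).trans (hn.trans_eq ?_)⟩
  rw [testRadius, sub_sub_cancel, one_div_one_div, Real.norm_of_nonneg (by positivity)]
  ring

theorem limsup_eq_top_of_tendsto_comp {α β R : Type*} [CompleteLinearOrder R]
    [TopologicalSpace R] [OrderTopology R] {l : Filter α} {l' : Filter β} [l.NeBot] {f : β → R}
    {x : α → β} (hx : Tendsto x l l') (hf : Tendsto (f ∘ x) l (𝓝 ⊤)) : limsup f l' = ⊤ := by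
  refine top_unique ?_
  calc ⊤ = limsup (f ∘ x) l := hf.limsup_eq.symm
    _ ≤ limsup f l' := limsup_le_limsup_of_le hx

theorem exists_mem_harmonicHardyHK_limsup_eq_top {ψ : ℝ → ℝ}
    (hψ : ∀ r : ℝ, 0 ≤ r → r < 1 → 0 < ψ r)
    (ho : ψ =o[𝓝[<] (1 : ℝ)] fun r : ℝ => 1 / (1 - r)) :
    ∃ u ∈ harmonicHardyHK, ∀ p : ℝ≥0∞, 1 ≤ p →
      limsup (fun r : ℝ => sliceLpNorm u p r / ENNReal.ofReal (ψ r)) (𝓝[<] (1 : ℝ)) = ∞ := by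
  choose n hn hψn using fun k : ℕ =>
    exists_lt_testRadius_le_mul ho (ε := (1 / 4) ^ (k + 1)) (by positivity) k
  have hb₀ (k : ℕ) : (0 : ℝ) ≤ (1 / 2) ^ k := by positivity
  have hb : Summable fun k : ℕ => (1 / 2 : ℝ) ^ k := summable_geometric_two
  set u : ℂ → ℝ := fun z => (gapSeries (fun k => (1 / 2) ^ k) n z).re
  refine ⟨u, re_gapSeries_mem_harmonicHardyHK hb n, fun p hp => ?_⟩
  set x : ℕ → ℝ := fun k => testRadius (n k)
  have hx : Tendsto x atTop (𝓝[<] 1) :=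
    tendsto_testRadius.comp (tendsto_atTop_mono (fun k => (hn k).le) tendsto_id)
  have hratio (k : ℕ) :
      ENNReal.ofReal (2 ^ k) ≤ sliceLpNorm u p (x k) / ENNReal.ofReal (ψ (x k)) := by
    have hnk : 0 < n k := (Nat.zero_le k).trans_lt (hn k)
    obtain ⟨hx₀, hx₁⟩ := testRadius_mem_Ico hnk
    rw [ENNReal.le_div_iff_mul_le (Or.inl (ENNReal.ofReal_pos.2 (hψ _ hx₀ hx₁)).ne')
      (Or.inl ENNReal.ofReal_ne_top), ← ENNReal.ofReal_mul (by positivity)]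
    calc ENNReal.ofReal (2 ^ k * ψ (x k))
        ≤ ENNReal.ofReal ((1 / 2) ^ k * (n k * x k ^ n k) / 2) := by
          refine ENNReal.ofReal_le_ofReal ?_
          calc 2 ^ k * ψ (x k) ≤ 2 ^ k * ((1 / 4) ^ (k + 1) * n k) := by
                gcongr
                exact hψn k
            _ = (1 / 2) ^ k * (n k * (1 / 2)) / 2 := by
                rw [show (1 / 2 : ℝ) = 2 * (1 / 4) by norm_num, mul_pow]
                ring
            _ ≤ (1 / 2) ^ k * (n k * x k ^ n k) / 2 := by
                gcongr
                exact half_le_testRadius_pow hnk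
      _ ≤ sliceLpNorm u p (x k) := ofReal_le_sliceLpNorm_gapSeries hb₀ hb n hx₀ hx₁ k hp
  have hpow : Tendsto (fun k : ℕ => ENNReal.ofReal (2 ^ k)) atTop (𝓝 ∞) :=
    ENNReal.tendsto_ofReal_atTop.comp (tendsto_pow_atTop_atTop_of_one_lt one_lt_two)
  exact limsup_eq_top_of_tendsto_comp hx
    (tendsto_nhds_top_mono hpow (Eventually.of_forall hratio))

theorem mainTheorem6_general :
    (∀ p : ℝ≥0∞, 0 < p → ∀ u ∈ harmonicHardyHK,
      (∀ r : ℝ, 1 / 2 ≤ r → r < 1 →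
        sliceLpNorm u p r ≤
          ENNReal.ofReal (periodFactor p * (2 * r / (π * (1 - r)))) * hkNorm u) ∧
      (∀ r : ℝ, 0 ≤ r → r ≤ 1 / 2 →
        sliceLpNorm u p r ≤ ENNReal.ofReal (periodFactor p * (2 / π)) * hkNorm u)) ∧
    (∀ ψ : ℝ → ℝ, (∀ r : ℝ, 0 ≤ r → r < 1 → 0 < ψ r) →
      ψ =o[𝓝[<] (1 : ℝ)] (fun r : ℝ => 1 / (1 - r)) →
      ∃ u ∈ harmonicHardyHK, ∀ p : ℝ≥0∞, 1 ≤ p →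
        limsup (fun r : ℝ => sliceLpNorm u p r / ENNReal.ofReal (ψ r)) (𝓝[<] (1 : ℝ)) = ∞) ∧
    (∃ u ∈ harmonicHardyHK, ∃ c : ℝ, 0 < c ∧ ∀ r : ℝ, 0 ≤ r → r < 1 →
      ENNReal.ofReal (c / (1 - r)) ≤ sliceLpNorm u ∞ r) :=
  ⟨fun p _ _ hu => ⟨fun _ => sliceLpNorm_le_of_half_le hu p,
      fun _ => sliceLpNorm_le_of_le_half hu p⟩,
    fun _ => exists_mem_harmonicHardyHK_limsup_eq_top,
    exists_ofReal_div_one_sub_le_sliceLpNorm_top⟩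

end

theorem mainTheorem6 :
    -- the estimates
    (∀ p : ℝ≥0∞, 1 ≤ p → ∀ u ∈ harmonicHardyHK,
      (∀ r : ℝ, 1 / 2 ≤ r → r < 1 →
        sliceLpNorm u p r ≤
          ENNReal.ofReal (periodFactor p * (2 * r / (Real.pi * (1 - r)))) * hkNorm u) ∧
      (∀ r : ℝ, 0 ≤ r → r ≤ 1 / 2 →
        sliceLpNorm u p r ≤
          ENNReal.ofReal (periodFactor p * (2 / Real.pi)) * hkNorm u)) ∧
    -- sharpness of the order `1 / (1 - r)` as `r → 1`, for each `p`
    (∀ p : ℝ≥0∞, 1 ≤ p → ∀ ψ : ℝ → ℝ, (∀ r : ℝ, 0 ≤ r → r < 1 → 0 < ψ r) →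
      ψ =o[𝓝[<] (1 : ℝ)] (fun r : ℝ => 1 / (1 - r)) →
      ∃ u ∈ harmonicHardyHK,
        limsup (fun r : ℝ => sliceLpNorm u p r / ENNReal.ofReal (ψ r)) (𝓝[<] (1 : ℝ)) = ∞) ∧
    -- for `p = ∞` the order `1 / (1 - r)` is attained
    (∃ u ∈ harmonicHardyHK, ∃ c : ℝ, 0 < c ∧ ∀ r : ℝ, 0 ≤ r → r < 1 →
      ENNReal.ofReal (c / (1 - r)) ≤ sliceLpNorm u ∞ r) := by
  obtain ⟨hbounds, hsharp, hattained⟩ := mainTheorem6_general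
  exact ⟨fun p hp => hbounds p (one_pos.trans_le hp),
    fun p hp ψ hψ ho => (hsharp ψ hψ ho).imp fun _ hu => ⟨hu.1, hu.2 p hp⟩, hattained⟩
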